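/- Let $2^\omega$ carry coordinatewise addition modulo $2$ and the product topology. For $S\subseteq\omega$ let $\mathcal M(2^{S})$ be the family of meager subsets of $2^S$ and let $\mathcal N(2^{S})$ be the family of null subsets of $2^S$ for the product of the uniform measures on $\{0,1\}$. For $A\subseteq\omega$ let $\mathcal I_A=\mathcal M(2^{A})\otimes\mathcal N(2^{\omega\setminus A})$, where $2^\omega$ is identified with $2^A\times 2^{\omega\setminus A}$ by restriction; that is, $K\in\mathcal I_A$ if and only if there is a Borel set $C\supseteq K$ such that $$\{x\in 2^A:\ C_x\notin\mathcal N(2^{\omega\setminus A})\}\in\mathcal M(2^A),\qquad C_x=\{y\restriction(\omega\setminus A):\ y\in C,\ y\restriction A=x\}.$$ A $\sigma$-ideal $\mathcal I$ on $2^\omega$ has a Borel base if every member of $\mathcal I$ is contained in a Borel member of $\mathcal I$. It is called a maximal invariant $\sigma$-ideal with a Borel base if it is maximal, with respect to inclusion, among the proper translation-invariant $\sigma$-ideals on $2^\omega$ that contain all singletons and have a Borel base. It has the Weaker Smital Property (WSP) if there is a countable dense set $D\subseteq 2^\omega$ such that $2^\omega\setminus(B+D)\in\mathcal I$ for every Borel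 set $B\notin\mathcal I$. A family $\mathcal A$ of infinite subsets of $\omega$ is almost disjoint if $A\cap A'$ is finite for all distinct $A,A'\in\mathcal A$. **Theorem.** There are at least $\mathfrak c$ pairwise distinct maximal invariant $\sigma$-ideals with Borel bases on $2^\omega$. More precisely, there is an almost disjoint family of cardinality $\mathfrak c$ of infinite subsets of $\omega$, and for every such family $\mathcal A$: 1. for each $A\in\mathcal A$, the family $\mathcal I_A$ has WSP and is a maximal invariant $\sigma$-ideal with a Borel base; 2. $\mathcal I_A\neq\mathcal I_{A'}$ for all distinct $A,A'\in\mathcal A$. -/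

import Mathlib

open MeasureTheory Set
open scoped Pointwise Cardinal

/-- A family of subsets of `X` which is a (not necessarily proper) σ-ideal. -/
structure IsSigmaIdeal {X : Type*} (I : Set (Set X)) : Prop where
  empty_mem : ∅ ∈ I
  mem_of_subset : ∀ A B : Set X, B ∈ I → A ⊆ B → A ∈ I
  iUnion_mem : ∀ A : ℕ → Set X, (∀ n, A n ∈ I) → (⋃ n, A n) ∈ I

/-- `I` has a Borel base: every member is covered by a Borel member. -/
def HasBorelBase {X : Type*} [TopologicalSpace X] [MeasurableSpace X] [BorelSpace X]
    (I : Set (Set X)) : Prop :=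
  ∀ K ∈ I, ∃ B ∈ I, MeasurableSet B ∧ K ⊆ B

/-- `I` is invariant under all translations of the group `X`. -/
def IsTranslationInvariant {X : Type*} [AddCommGroup X] (I : Set (Set X)) : Prop :=
  ∀ A ∈ I, ∀ x : X, (fun a => x + a) '' A ∈ I

/-- `I` is a proper invariant σ-ideal with a Borel base on `X`, containing all singletons. -/
structure IsInvariantBorelIdeal {X : Type*} [TopologicalSpace X] [MeasurableSpace X]
    [BorelSpace X] [AddCommGroup X] (I : Set (Set X)) : Prop where
  isSigmaIdeal : IsSigmaIdeal I
  proper : (Set.univ : Set X) ∉ I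
  singleton_mem : ∀ x : X, {x} ∈ I
  invariant : IsTranslationInvariant I
  borelBase : HasBorelBase I

/-- `I` is maximal, with respect to inclusion, among the proper invariant σ-ideals with Borel
bases on `X`. -/
def IsMaximalInvariantBorelIdeal {X : Type*} [TopologicalSpace X] [MeasurableSpace X]
    [BorelSpace X] [AddCommGroup X] (I : Set (Set X)) : Prop :=
  Maximal IsInvariantBorelIdeal I

/-- The Weaker Smital Property of `I` (with respect to the Borel σ-algebra): there is a countable
dense set `D` such that `A + D` is `I`-residual for every Borel set `A` not in `I`. -/
def HasWSP {X : Type*} [TopologicalSpace X] [MeasurableSpace X] [BorelSpace X]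
    [AddCommGroup X] (I : Set (Set X)) : Prop :=
  ∃ D : Set X, D.Countable ∧ Dense D ∧
    ∀ A : Set X, MeasurableSet A → A ∉ I → (A + D)ᶜ ∈ I

/-- The Fubini product `I ⊗ J`: the sets covered by a set `C` of the product σ-algebra such that
the set of those `x` for which the vertical section `C_x` is not in `J` belongs to `I`. -/
def fubiniProduct {X Y : Type*} [MeasurableSpace X] [MeasurableSpace Y]
    (I : Set (Set X)) (J : Set (Set Y)) : Set (Set (X × Y)) :=
  {K | ∃ C : Set (X × Y), MeasurableSet C ∧ K ⊆ C ∧ {x | {y | (x, y) ∈ C} ∉ J} ∈ I}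

/-- The group `2^S` with coordinatewise addition modulo 2, the product topology and the product
(= Borel) σ-algebra. -/
abbrev CantorGroup (S : Type) : Type := S → ZMod 2

/-- The fair coin measure on `2^S`: the product of the uniform measures on `{0, 1}`. -/
noncomputable def coinMeasure (S : Type) : Measure (CantorGroup S) :=
  Measure.infinitePi fun _ : S => (PMF.uniformOfFintype (ZMod 2)).toMeasure

/-- The family of meager subsets of `2^S`. -/
def meagerIdeal (S : Type) : Set (Set (CantorGroup S)) := {A | IsMeagre A}

/-- The family of null subsets of `2^S`. -/
def nullIdeal (S : Type) : Set (Set (CantorGroup S)) := {A | coinMeasure S A = 0}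

/-- The canonical bijection from `2^ω` to `2^A × 2^(ω \ A)`, sending `x` to its two
restrictions. -/
def splitAlong (A : Set ℕ) (x : CantorGroup ℕ) :
    CantorGroup A × CantorGroup (Aᶜ : Set ℕ) :=
  (fun i => x i, fun i => x i)

/-- The ideal "meager on `2^A` ⊗ null on `2^(ω \ A)`", regarded as a family of subsets of `2^ω`. -/
def meagerNullIdeal (A : Set ℕ) : Set (Set (CantorGroup ℕ)) :=
  {K | splitAlong A '' K ∈ fubiniProduct (meagerIdeal A) (nullIdeal (Aᶜ : Set ℕ))}

/-- `𝒜` is an almost disjoint family on `ω`: its members are infinite, and any two distinct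
members have finite intersection. -/
def IsAlmostDisjointFamily (𝒜 : Set (Set ℕ)) : Prop :=
  (∀ A ∈ 𝒜, A.Infinite) ∧ ∀ A ∈ 𝒜, ∀ B ∈ 𝒜, A ≠ B → (A ∩ B).Finite

/-! ### The coin measure -/

/-! WSP forces maximality (`HasWSP.isMaximal`): a strictly larger invariant ideal contains a Borel
`B` outside `I`, and the countably many translates `B + d` together with `(B + D)ᶜ ∈ I` cover the
whole group. WSP for `meagerNullIdeal A` is witnessed by the finitely supported sequences, which
split along `A`. If `B` is Borel and not in the ideal, the set `E` of `x` whose section of `B` is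
non-null is non-meager, so `E` plus the finitely supported elements is comeager in `2^A`. Over each
point `e + q` of that sum, the section of `B + D` contains a translate-saturation of `B_e`, which is
conull by a zero-one law. For distinctness, almost disjointness makes `B \ A` infinite. A null
comeager set in `2^(B \ A)` then has a cylinder lying in the ideal of `A` whose complement lies in
the ideal of `B`. -/

instance isProbabilityMeasure_coinMeasure (S : Type) : IsProbabilityMeasure (coinMeasure S) := by
  unfold coinMeasure; infer_instance

lemma coinMeasure_pi {S : Type} (s : Finset S) (t : S → Set (ZMod 2)) :
    coinMeasure S (Set.pi s t) =
      ∏ i ∈ s, (PMF.uniformOfFintype (ZMod 2)).toMeasure (t i) :=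
  Measure.infinitePi_pi _ fun _ _ => MeasurableSet.of_discrete

lemma uniform_toMeasure_preimage_add (a : ZMod 2) (t : Set (ZMod 2)) :
    (PMF.uniformOfFintype (ZMod 2)).toMeasure ((a + ·) ⁻¹' t) =
      (PMF.uniformOfFintype (ZMod 2)).toMeasure t := by
  classical
  rw [PMF.toMeasure_uniformOfFintype_apply _ MeasurableSet.of_discrete,
    PMF.toMeasure_uniformOfFintype_apply _ MeasurableSet.of_discrete]
  congr 2
  exact Fintype.card_congr ((Equiv.addLeft a).subtypeEquiv fun _ => Iff.rfl)

instance isAddLeftInvariant_coinMeasure (S : Type) : (coinMeasure S).IsAddLeftInvariant := by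
  refine ⟨fun x => Measure.eq_infinitePi _ fun s t ht => ?_⟩
  rw [Measure.map_apply (by fun_prop)
    (MeasurableSet.pi s.countable_toSet fun i _ => ht i)]
  have h : (x + ·) ⁻¹' (Set.pi s t) = Set.pi s fun i => (x i + ·) ⁻¹' t i := by
    ext y; simp [Set.mem_pi]
  rw [h, coinMeasure_pi]
  simp only [uniform_toMeasure_preimage_add]

lemma coinMeasure_singleton {S : Type} [Infinite S] (x : CantorGroup S) :
    coinMeasure S {x} = 0 := by
  have h : ∀ n : ℕ, coinMeasure S {x} ≤ (2⁻¹ : ENNReal) ^ n := fun n => by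
    obtain ⟨s, hs⟩ := Infinite.exists_subset_card_eq S n
    calc coinMeasure S {x} ≤ coinMeasure S (Set.pi s fun i => {x i}) :=
          measure_mono (by rintro _ rfl i _; rfl)
      _ = 2⁻¹ ^ n := by
          rw [coinMeasure_pi]
          simp [hs]
  exact le_antisymm (ge_of_tendsto' (ENNReal.tendsto_pow_atTop_nhds_zero_of_lt_one (by simp)) h) zero_le

/-- Restricting along an injection preserves the coin measures. -/
lemma measurePreserving_comp_coinMeasure {S T : Type} {f : T → S} (hf : f.Injective) :
    MeasurePreserving (fun (x : CantorGroup S) i => x (f i)) (coinMeasure S) (coinMeasure T) := by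
  have hm : Measurable fun (x : CantorGroup S) (i : T) => x (f i) := by fun_prop
  refine ⟨hm, Measure.eq_infinitePi _ fun s t ht => ?_⟩
  rw [Measure.map_apply hm (MeasurableSet.pi s.countable_toSet fun i _ => ht i)]
  have h : (fun (x : CantorGroup S) i => x (f i)) ⁻¹' (Set.pi s t) =
      Set.pi (s.map ⟨f, hf⟩) fun j => {a | ∀ i, f i = j → a ∈ t i} := by
    ext x
    simp only [Set.mem_preimage, Set.mem_pi, Finset.mem_coe, Finset.mem_map, mem_ofPred_eq,
      Function.Embedding.coeFn_mk]
    constructor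
    · rintro h _ ⟨i, hi, rfl⟩ j hj
      rw [hf hj]
      exact h i hi
    · exact fun h i hi => h _ ⟨i, hi, rfl⟩ i rfl
  rw [h, coinMeasure_pi, Finset.prod_map]
  refine Finset.prod_congr rfl fun i _ => congrArg _ ?_
  ext a
  exact ⟨fun h => h i rfl, fun h j hj => hf hj ▸ h⟩

lemma isOpenMap_comp_cantorGroup {S T : Type} {f : T → S} (hf : f.Injective) :
    IsOpenMap fun (x : CantorGroup S) i => x (f i) := by
  classical
  -- The continuous section through `x` overwrites the coordinates in the range of `f` and keeps
  -- those of `x` elsewhere.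
  refine IsOpenMap.of_sections fun x =>
    ⟨fun y => Function.extend f y x, ?_, ?_, fun y => ?_⟩
  · refine (continuous_pi fun j => ?_).continuousAt
    by_cases hj : ∃ i, f i = j
    · obtain ⟨i, rfl⟩ := hj
      simpa only [hf.extend_apply] using continuous_apply i
    · simpa only [Function.extend_apply' _ _ _ hj] using continuous_const
  · ext j
    by_cases hj : ∃ i, f i = j
    · obtain ⟨i, rfl⟩ := hj
      simp only [hf.extend_apply]
    · simp only [Function.extend_apply' _ _ _ hj]
  · ext i
    simp only [hf.extend_apply]

/-- A group `2^S` with `S` countably infinite has a null residual Borel subset. -/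
lemma exists_measurableSet_null_residual (S : Type) [Countable S] [Infinite S] :
    ∃ G : Set (CantorGroup S), MeasurableSet G ∧ coinMeasure S G = 0 ∧ IsMeagre Gᶜ := by
  obtain ⟨D, hDc, hDd⟩ := TopologicalSpace.exists_countable_dense (CantorGroup S)
  have hD : coinMeasure S D = 0 := by
    rw [← biUnion_of_singleton D, measure_biUnion_null_iff hDc]
    exact fun x _ => coinMeasure_singleton x
  -- Outer regularity around a null dense set; the intersection of the `U n` is a null dense Gδ.
  have hU : ∀ n : ℕ, ∃ U ⊇ D, IsOpen U ∧ coinMeasure S U < 2⁻¹ ^ n := fun n =>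
    D.exists_isOpen_lt_of_lt _ (by rw [hD]; exact ENNReal.pow_pos (by simp) n)
  choose U hDU hUo hUm using hU
  refine ⟨⋂ n, U n, .iInter fun n => (hUo n).measurableSet, ?_, ?_⟩
  · refine le_antisymm (ge_of_tendsto'
      (ENNReal.tendsto_pow_atTop_nhds_zero_of_lt_one (by simp : (2⁻¹ : ENNReal) < 1)) fun n => ?_) zero_le
    exact (measure_mono (iInter_subset U n)).trans (hUm n).le
  · rw [IsMeagre, compl_compl]
    exact countable_iInter_mem.2 fun n =>
      residual_of_dense_open (hUo n) (hDd.mono (hDU n))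

/-! ### Smital properties -/

lemma IsMeagre.preimage_homeomorph {X Y : Type*} [TopologicalSpace X] [TopologicalSpace Y]
    {s : Set Y} (hs : IsMeagre s) (h : X ≃ₜ Y) : IsMeagre (h ⁻¹' s) :=
  hs.preimage_of_isOpenMap h.continuous h.isOpenMap

/-- By the Baire property `E` agrees with a nonempty open `U` up to a meager set. Each `x` has some
`d ∈ D` with `x - d ∈ U`, so `x ∉ E + D` puts `x` in one of countably many translates of `U \ E`. -/
lemma isMeagre_compl_add_of_dense {G : Type*} [AddCommGroup G] [TopologicalSpace G]
    [IsTopologicalAddGroup G] [MeasurableSpace G] [BorelSpace G] {E D : Set G}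
    (hE : MeasurableSet E) (hE' : ¬ IsMeagre E) (hDc : D.Countable) (hD : Dense D) :
    IsMeagre (E + D)ᶜ := by
  obtain ⟨U, hU, hEU⟩ := hE.residualEq_isOpen
  have hm : IsMeagre (U \ E) := by
    filter_upwards [hEU.mem_iff] with x hx h
    exact h.2 (hx.2 h.1)
  obtain ⟨u, hu⟩ : U.Nonempty := by
    by_contra h
    rw [not_nonempty_iff_eq_empty] at h
    refine hE' ?_
    filter_upwards [hEU.mem_iff] with x hx h'
    simpa [h] using hx.1 h'
  have : Countable D := hDc
  refine (isMeagre_iUnion fun d : D =>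
    hm.preimage_homeomorph (Homeomorph.subRight (d : G))).mono fun x hx => ?_
  obtain ⟨d, hd, hdD⟩ := hD.inter_open_nonempty ((x - ·) ⁻¹' U)
    (hU.preimage (by fun_prop)) ⟨x - u, by simpa⟩
  refine mem_iUnion.2 ⟨⟨d, hdD⟩, hd, fun h => hx ?_⟩
  exact ⟨x - d, h, d, hdD, sub_add_cancel x d⟩

-- Since `D` is a subgroup, `E + D` is invariant under a dense set of translations, so ergodicity
-- makes it null or conull; it contains the non-null set `E`.
set_option synthInstance.maxSize 512 in
lemma coinMeasure_compl_add_of_dense {S : Type} [Countable S] {E : Set (CantorGroup S)}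
    (D : AddSubgroup (CantorGroup S)) (hE : MeasurableSet E) (hE' : coinMeasure S E ≠ 0)
    (hDc : (D : Set (CantorGroup S)).Countable) (hD : Dense (D : Set (CantorGroup S))) :
    coinMeasure S (E + D)ᶜ = 0 := by
  have hm : MeasurableSet (E + (D : Set (CantorGroup S))) := by
    rw [← iUnion_add_right_image]
    exact .biUnion hDc fun d _ => (measurableEmbedding_addRight d).measurableSet_image.2 hE
  have hir : (coinMeasure S).InnerRegular := by unfold coinMeasure; infer_instance
  have hinv : Dense {g : CantorGroup S | (g +ᵥ ·) ⁻¹' (E + (D : Set (CantorGroup S))) =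
      E + (D : Set (CantorGroup S))} := by
    refine hD.mono fun g hg => ?_
    ext x
    constructor
    · rintro ⟨e, he, d, hd, h⟩
      refine ⟨e, he, d - g, D.sub_mem hd hg, ?_⟩
      simp only [vadd_eq_add] at h ⊢
      rw [← add_sub_assoc, h, add_sub_cancel_left]
    · rintro ⟨e, he, d, hd, rfl⟩
      refine ⟨e, he, g + d, D.add_mem hg hd, ?_⟩
      simp only [vadd_eq_add]
      exact add_left_comm e g d
  have hc := aeconst_of_dense_setOfPred_preimage_vadd_eq (μ := coinMeasure S)
    hm.nullMeasurableSet hinv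
  rcases Filter.eventuallyConst_set.1 hc with h | h
  · exact h
  · refine absurd (measure_mono_null (fun e he => ?_) h) hE'
    exact fun h' => h' ⟨e, he, 0, D.zero_mem, add_zero e⟩

/-- The group of finitely supported elements of `2^S`. -/
def finiteSupportSubgroup (S : Type) : AddSubgroup (CantorGroup S) where
  carrier := {x | (Function.support x).Finite}
  zero_mem' := by simp [Function.support]
  add_mem' hx hy := Set.Finite.subset (Set.Finite.union hx hy) (Function.support_add _ _)
  neg_mem' {x} hx := by simpa [Function.support_neg] using hx

lemma countable_finiteSupportSubgroup (S : Type) [Countable S] :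
    (finiteSupportSubgroup S : Set (CantorGroup S)).Countable :=
  Set.Countable.mono (fun x hx => mem_range.2 ⟨Finsupp.ofSupportFinite x hx, rfl⟩)
    (countable_range fun f : S →₀ ZMod 2 => (f : S → ZMod 2))

lemma dense_finiteSupportSubgroup (S : Type) :
    Dense (finiteSupportSubgroup S : Set (CantorGroup S)) := by
  classical
  intro x
  refine mem_closure_of_tendsto (f := fun s : Finset S => fun i => if i ∈ s then x i else 0)
    (b := Filter.atTop) (tendsto_pi_nhds.2 fun i => ?_) (.of_forall fun s => ?_)
  · refine tendsto_const_nhds.congr' ?_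
    filter_upwards [Filter.eventually_ge_atTop {i}] with s hs
    rw [if_pos (Finset.singleton_subset_iff.1 hs)]
  · exact s.finite_toSet.subset fun i hi => by
      by_contra h
      exact hi (if_neg h)

/-- An invariant Borel ideal with the Weaker Smital Property is maximal. -/
lemma HasWSP.isMaximal {X : Type*} [TopologicalSpace X] [MeasurableSpace X] [BorelSpace X]
    [AddCommGroup X] {I : Set (Set X)} (hW : HasWSP I) (hI : IsInvariantBorelIdeal I) :
    IsMaximalInvariantBorelIdeal I := by
  refine ⟨hI, fun J hJ hIJ K hK => ?_⟩
  by_contra hKI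
  obtain ⟨B, hBJ, hB, hKB⟩ := hJ.borelBase K hK
  obtain ⟨D, hDc, hDd, hD⟩ := hW
  have hBI : B ∉ I := fun h => hKI (hI.isSigmaIdeal.mem_of_subset _ _ h hKB)
  -- If `D` were empty, `(B + D)ᶜ` would be everything, against properness.
  obtain ⟨f, hf⟩ := hDc.exists_eq_range (by
    by_contra hne
    rw [not_nonempty_iff_eq_empty] at hne
    have := hD B hB hBI
    simp only [hne, add_empty, compl_empty] at this
    exact hI.proper this)
  let A : ℕ → Set X := fun n => Nat.casesOn n (B + D)ᶜ fun n => (fun a => f n + a) '' B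
  refine hJ.proper (hJ.isSigmaIdeal.mem_of_subset _ _ (hJ.isSigmaIdeal.iUnion_mem A ?_) ?_)
  · rintro (_ | n)
    · exact hIJ (hD B hB hBI)
    · exact hJ.invariant B hBJ _
  · intro x _
    by_cases hx : x ∈ B + D
    · obtain ⟨b, hb, d, hd, rfl⟩ := hx
      rw [hf] at hd
      obtain ⟨n, rfl⟩ := hd
      exact mem_iUnion.2 ⟨n + 1, b, hb, add_comm _ _⟩
    · exact mem_iUnion.2 ⟨0, hx⟩

/-! ### The ideals `meagerNullIdeal A` -/

open Classical in
/-- The inverse of `splitAlong A`. -/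
noncomputable def glue (A : Set ℕ) (x : CantorGroup A) (y : CantorGroup (Aᶜ : Set ℕ)) :
    CantorGroup ℕ :=
  fun i => if h : i ∈ A then x ⟨i, h⟩ else y ⟨i, h⟩

lemma glue_of_mem {A : Set ℕ} (x : CantorGroup A) (y : CantorGroup (Aᶜ : Set ℕ)) {i : ℕ}
    (h : i ∈ A) : glue A x y i = x ⟨i, h⟩ := dif_pos h

lemma glue_of_notMem {A : Set ℕ} (x : CantorGroup A) (y : CantorGroup (Aᶜ : Set ℕ)) {i : ℕ}
    (h : i ∉ A) : glue A x y i = y ⟨i, h⟩ := dif_neg h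

lemma splitAlong_glue (A : Set ℕ) (x : CantorGroup A) (y : CantorGroup (Aᶜ : Set ℕ)) :
    splitAlong A (glue A x y) = (x, y) :=
  Prod.ext (funext fun i => glue_of_mem x y i.2) (funext fun i => glue_of_notMem x y i.2)

lemma glue_splitAlong (A : Set ℕ) (z : CantorGroup ℕ) :
    glue A (splitAlong A z).1 (splitAlong A z).2 = z := by
  ext i
  by_cases h : i ∈ A
  · exact glue_of_mem _ _ h
  · exact glue_of_notMem _ _ h

lemma glue_add (A : Set ℕ) (x x' : CantorGroup A) (y y' : CantorGroup (Aᶜ : Set ℕ)) :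
    glue A (x + x') (y + y') = glue A x y + glue A x' y' := by
  ext i
  by_cases h : i ∈ A
  · simp only [Pi.add_apply, glue_of_mem _ _ h]
  · simp only [Pi.add_apply, glue_of_notMem _ _ h]

lemma measurable_splitAlong (A : Set ℕ) : Measurable (splitAlong A) := by
  unfold splitAlong
  fun_prop

lemma measurable_glue (A : Set ℕ) :
    Measurable fun p : CantorGroup A × CantorGroup (Aᶜ : Set ℕ) => glue A p.1 p.2 := by
  refine measurable_pi_lambda _ fun i => ?_
  by_cases h : i ∈ A
  · simp only [glue_of_mem _ _ h]
    fun_prop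
  · simp only [glue_of_notMem _ _ h]
    fun_prop

lemma mem_meagerNullIdeal_iff {A : Set ℕ} {K : Set (CantorGroup ℕ)} :
    K ∈ meagerNullIdeal A ↔ ∃ C, MeasurableSet C ∧ K ⊆ C ∧
      IsMeagre {x | coinMeasure (Aᶜ : Set ℕ) {y | glue A x y ∈ C} ≠ 0} := by
  constructor
  · rintro ⟨C, hC, hKC, h⟩
    refine ⟨splitAlong A ⁻¹' C, measurable_splitAlong A hC, image_subset_iff.1 hKC, ?_⟩
    simp only [mem_preimage, splitAlong_glue]
    exact h
  · rintro ⟨C, hC, hKC, h⟩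
    refine ⟨_, measurable_glue A hC, ?_, h⟩
    rintro _ ⟨z, hz, rfl⟩
    simpa only [mem_preimage, glue_splitAlong] using hKC hz

/-- A Borel set can serve as its own cover, since passing to a subset only shrinks sections. -/
lemma MeasurableSet.mem_meagerNullIdeal_iff {A : Set ℕ} {C : Set (CantorGroup ℕ)}
    (hC : MeasurableSet C) : C ∈ meagerNullIdeal A ↔
      IsMeagre {x | coinMeasure (Aᶜ : Set ℕ) {y | glue A x y ∈ C} ≠ 0} := by
  rw [_root_.mem_meagerNullIdeal_iff]
  refine ⟨?_, fun h => ⟨C, hC, Subset.rfl, h⟩⟩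
  rintro ⟨C', -, hCC', h⟩
  exact h.mono fun x hx h' => hx (measure_mono_null (fun y hy => hCC' hy) h')

lemma isSigmaIdeal_meagerNullIdeal (A : Set ℕ) : IsSigmaIdeal (meagerNullIdeal A) where
  empty_mem := by
    rw [MeasurableSet.empty.mem_meagerNullIdeal_iff]
    simp [IsMeagre.empty]
  mem_of_subset K L hL hKL := by
    obtain ⟨C, hC, hLC, h⟩ := mem_meagerNullIdeal_iff.1 hL
    exact mem_meagerNullIdeal_iff.2 ⟨C, hC, hKL.trans hLC, h⟩
  iUnion_mem K hK := by
    choose C hC hKC h using fun n => mem_meagerNullIdeal_iff.1 (hK n)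
    refine mem_meagerNullIdeal_iff.2
      ⟨⋃ n, C n, .iUnion hC, iUnion_mono hKC, (isMeagre_iUnion h).mono fun x hx => ?_⟩
    by_contra hx'
    simp only [mem_iUnion, mem_ofPred_eq, not_exists, not_not] at hx'
    refine hx ?_
    have : {y | glue A x y ∈ ⋃ n, C n} = ⋃ n, {y | glue A x y ∈ C n} := by ext; simp
    rw [this]
    exact measure_iUnion_null hx'

lemma univ_notMem_meagerNullIdeal (A : Set ℕ) : univ ∉ meagerNullIdeal A := by
  rw [MeasurableSet.univ.mem_meagerNullIdeal_iff]
  simp only [mem_univ, ofPred_true, measure_univ, ne_eq, one_ne_zero, not_false_eq_true]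
  exact not_isMeagre_of_isOpen isOpen_univ univ_nonempty

lemma not_isOpen_singleton_cantorGroup {S : Type} [Infinite S] (x : CantorGroup S) :
    ¬ IsOpen {x} := by
  classical
  intro h
  obtain ⟨s, u, hu, hsub⟩ := isOpen_pi_iff.1 h x rfl
  obtain ⟨j, hj⟩ := Infinite.exists_notMem_finset s
  have : Function.update x j (x j + 1) ∈ (s : Set S).pi u := fun i hi => by
    rw [Function.update_of_ne (by rintro rfl; exact hj hi)]
    exact (hu i hi).2
  have := congrFun (hsub this) j
  simp at this

lemma isMeagre_singleton_cantorGroup {S : Type} [Infinite S] (x : CantorGroup S) :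
    IsMeagre {x} := by
  rw [IsMeagre]
  refine residual_of_dense_open isOpen_compl_singleton (dense_compl_singleton_iff_not_open.2 ?_)
  exact not_isOpen_singleton_cantorGroup x

lemma singleton_mem_meagerNullIdeal {A : Set ℕ} (hA : A.Infinite) (z : CantorGroup ℕ) :
    {z} ∈ meagerNullIdeal A := by
  have := hA.to_subtype
  rw [(measurableSet_singleton z).mem_meagerNullIdeal_iff]
  -- Smallness comes from the category side alone, so `Aᶜ` may be finite.
  refine (isMeagre_singleton_cantorGroup (splitAlong A z).1).mono fun x hx => ?_
  by_contra hne
  refine hx ?_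
  convert measure_empty (μ := coinMeasure (Aᶜ : Set ℕ))
  refine eq_empty_of_forall_notMem fun y hy => hne ?_
  rw [← (hy : glue A x y = z), splitAlong_glue]
  rfl

lemma isTranslationInvariant_meagerNullIdeal (A : Set ℕ) :
    IsTranslationInvariant (meagerNullIdeal A) := by
  intro K hK g
  obtain ⟨C, hC, hKC, h⟩ := mem_meagerNullIdeal_iff.1 hK
  refine mem_meagerNullIdeal_iff.2 ⟨(-g + ·) ⁻¹' C, measurable_const_add _ hC, ?_, ?_⟩
  · rintro _ ⟨z, hz, rfl⟩
    simpa using hKC hz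
  · refine IsMeagre.mono (fun x hx => ?_)
      (h.preimage_homeomorph (Homeomorph.addLeft (splitAlong A (-g)).1))
    refine fun h' => hx ?_
    have : {y | glue A x y ∈ (-g + ·) ⁻¹' C} = ((splitAlong A (-g)).2 + ·) ⁻¹'
        {y | glue A ((splitAlong A (-g)).1 + x) y ∈ C} := by
      ext y
      simp only [mem_preimage, mem_ofPred_eq, glue_add, glue_splitAlong]
    rw [this, measure_preimage_add]
    exact h'

lemma isInvariantBorelIdeal_meagerNullIdeal {A : Set ℕ} (hA : A.Infinite) :
    IsInvariantBorelIdeal (meagerNullIdeal A) where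
  isSigmaIdeal := isSigmaIdeal_meagerNullIdeal A
  proper := univ_notMem_meagerNullIdeal A
  singleton_mem := singleton_mem_meagerNullIdeal hA
  invariant := isTranslationInvariant_meagerNullIdeal A
  borelBase K hK := by
    obtain ⟨C, hC, hKC, h⟩ := mem_meagerNullIdeal_iff.1 hK
    exact ⟨C, hC.mem_meagerNullIdeal_iff.2 h, hC, hKC⟩

lemma glue_mem_finiteSupportSubgroup {A : Set ℕ} {x : CantorGroup A}
    {y : CantorGroup (Aᶜ : Set ℕ)} (hx : x ∈ finiteSupportSubgroup A)
    (hy : y ∈ finiteSupportSubgroup (Aᶜ : Set ℕ)) :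
    glue A x y ∈ finiteSupportSubgroup ℕ := by
  refine Set.Finite.subset ((Set.Finite.image Subtype.val hx).union
    (Set.Finite.image Subtype.val hy)) fun i hi => ?_
  rw [Function.mem_support] at hi
  by_cases h : i ∈ A
  · exact .inl ⟨⟨i, h⟩, by rwa [glue_of_mem _ _ h] at hi, rfl⟩
  · exact .inr ⟨⟨i, h⟩, by rwa [glue_of_notMem _ _ h] at hi, rfl⟩

lemma hasWSP_meagerNullIdeal (A : Set ℕ) : HasWSP (meagerNullIdeal A) := by
  refine ⟨finiteSupportSubgroup ℕ, countable_finiteSupportSubgroup ℕ,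
    dense_finiteSupportSubgroup ℕ, fun B hB hBI => ?_⟩
  have hBD : MeasurableSet (B + (finiteSupportSubgroup ℕ : Set (CantorGroup ℕ))) := by
    rw [← iUnion_add_right_image]
    exact .biUnion (countable_finiteSupportSubgroup ℕ) fun d _ =>
      (measurableEmbedding_addRight d).measurableSet_image.2 hB
  rw [hB.mem_meagerNullIdeal_iff] at hBI
  rw [hBD.compl.mem_meagerNullIdeal_iff]
  -- Measurability of the section measure is what gives this set the Baire property.
  have hE : MeasurableSet {x | coinMeasure (Aᶜ : Set ℕ) {y | glue A x y ∈ B} ≠ 0} :=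
    (measurable_measure_prodMk_left (ν := coinMeasure (Aᶜ : Set ℕ)) (measurable_glue A hB))
      (measurableSet_singleton 0).compl
  refine (isMeagre_compl_add_of_dense hE hBI (countable_finiteSupportSubgroup A)
    (dense_finiteSupportSubgroup A)).mono fun x hx => ?_
  rintro ⟨e, he, q, hq, rfl⟩
  refine hx (measure_mono_null ?_ (coinMeasure_compl_add_of_dense
    (finiteSupportSubgroup (Aᶜ : Set ℕ)) (measurable_prodMk_left (measurable_glue A hB)) he
    (countable_finiteSupportSubgroup _) (dense_finiteSupportSubgroup _)))
  rintro y hy ⟨c, hc, r, hr, rfl⟩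
  refine hy ?_
  change glue A (e + q) (c + r) ∈ _
  rw [glue_add]
  exact ⟨_, hc, _, glue_mem_finiteSupportSubgroup hq hr, rfl⟩

lemma meagerNullIdeal_ne {A B : Set ℕ} (h : (B \ A).Infinite) :
    meagerNullIdeal A ≠ meagerNullIdeal B := by
  have := h.to_subtype
  obtain ⟨G, hG, hG0, hGm⟩ := exists_measurableSet_null_residual (B \ A : Set ℕ)
  let r : CantorGroup ℕ → CantorGroup (B \ A : Set ℕ) := fun z i => z i
  have hK : MeasurableSet (r ⁻¹' G) := (by fun_prop : Measurable r) hG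
  have hKA : r ⁻¹' G ∈ meagerNullIdeal A := by
    rw [hK.mem_meagerNullIdeal_iff]
    -- Every section is a cylinder over `G`, hence null, so there are no exceptional `x` at all.
    convert IsMeagre.empty
    refine eq_empty_of_forall_notMem fun x hx => hx ?_
    let f : (B \ A : Set ℕ) → (Aᶜ : Set ℕ) := fun i => ⟨i, i.2.2⟩
    have hf : f.Injective := fun i j hij => Subtype.ext (Subtype.mk.inj hij)
    refine Eq.trans (congrArg _ ?_) (((measurePreserving_comp_coinMeasure hf).measure_preimage
      hG.nullMeasurableSet).trans hG0)
    ext y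
    have : r (glue A x y) = fun i => y (f i) := funext fun i => glue_of_notMem x y i.2.2
    simp only [mem_ofPred_eq, mem_preimage, this]
  have hKB : (r ⁻¹' G)ᶜ ∈ meagerNullIdeal B := by
    rw [hK.compl.mem_meagerNullIdeal_iff]
    let f : (B \ A : Set ℕ) → B := fun i => ⟨i, i.2.1⟩
    have hf : f.Injective := fun i j hij => Subtype.ext (Subtype.mk.inj hij)
    refine IsMeagre.mono (fun x hx => ?_) (hGm.preimage_of_isOpenMap
      (f := fun (x : CantorGroup B) i => x (f i)) (by fun_prop) (isOpenMap_comp_cantorGroup hf))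
    refine fun hxG => hx ?_
    convert measure_empty (μ := coinMeasure (Bᶜ : Set ℕ))
    refine eq_empty_of_forall_notMem fun y hy => hy ?_
    have : r (glue B x y) = fun i => x (f i) := funext fun i => glue_of_mem x y i.2.1
    rwa [mem_preimage, this]
  intro heq
  have hσ := isSigmaIdeal_meagerNullIdeal B
  refine univ_notMem_meagerNullIdeal B (hσ.mem_of_subset _ _
    (hσ.iUnion_mem (fun n => Nat.casesOn n (r ⁻¹' G) fun _ => (r ⁻¹' G)ᶜ) ?_) fun z _ => ?_)
  · rintro (_ | n)
    · exact heq ▸ hKA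
    · exact hKB
  · by_cases hz : z ∈ r ⁻¹' G
    · exact mem_iUnion.2 ⟨0, hz⟩
    · exact mem_iUnion.2 ⟨1, hz⟩

/-! ### Almost disjoint families -/

/-- The set of codes of the finite initial segments of a binary sequence. -/
def initialSegmentCodes (x : ℕ → Bool) : Set ℕ :=
  range fun n => Encodable.encode (List.ofFn fun i : Fin n => x i)

lemma eq_of_encode_ofFn_eq {x y : ℕ → Bool} {m n : ℕ}
    (h : Encodable.encode (List.ofFn fun i : Fin m => x i) =
      Encodable.encode (List.ofFn fun i : Fin n => y i)) : m = n ∧ ∀ i < n, x i = y i := by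
  have h := Encodable.encode_injective h
  have hmn : m = n := by simpa using congrArg List.length h
  subst hmn
  exact ⟨rfl, fun i hi => congrFun (List.ofFn_injective h) ⟨i, hi⟩⟩

lemma infinite_initialSegmentCodes (x : ℕ → Bool) : (initialSegmentCodes x).Infinite :=
  infinite_range_of_injective fun _ _ h => (eq_of_encode_ofFn_eq h).1

/-- A common code is a common prefix, whose length cannot exceed a position where `x` and `y`
differ. -/
lemma finite_inter_initialSegmentCodes {x y : ℕ → Bool} (h : x ≠ y) :
    (initialSegmentCodes x ∩ initialSegmentCodes y).Finite := by
  obtain ⟨k, hk⟩ := Function.ne_iff.1 h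
  refine ((finite_Iic k).image
    fun n => Encodable.encode (List.ofFn fun i : Fin n => x i)).subset ?_
  rintro _ ⟨⟨m, rfl⟩, ⟨n, hn⟩⟩
  refine ⟨m, ?_, rfl⟩
  by_contra hm
  exact hk ((eq_of_encode_ofFn_eq hn).2 k (not_le.1 hm)).symm

lemma exists_isAlmostDisjointFamily_mk_eq_continuum :
    ∃ 𝒜 : Set (Set ℕ), IsAlmostDisjointFamily 𝒜 ∧ #𝒜 = 𝔠 := by
  refine ⟨range initialSegmentCodes, ⟨?_, ?_⟩, ?_⟩
  · rintro _ ⟨x, rfl⟩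
    exact infinite_initialSegmentCodes x
  · rintro _ ⟨x, rfl⟩ _ ⟨y, rfl⟩ hne
    exact finite_inter_initialSegmentCodes fun h => hne (congrArg _ h)
  · rw [Cardinal.mk_range_eq]
    · simp
    · intro x y hxy
      by_contra hne
      have := finite_inter_initialSegmentCodes hne
      rw [hxy, inter_self] at this
      exact infinite_initialSegmentCodes y this

theorem mainTheorem4 :
    (∃ 𝒜 : Set (Set ℕ), IsAlmostDisjointFamily 𝒜 ∧ #𝒜 = 𝔠) ∧
    (∀ 𝒜 : Set (Set ℕ), IsAlmostDisjointFamily 𝒜 → #𝒜 = 𝔠 →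
      (∀ A ∈ 𝒜, HasWSP (meagerNullIdeal A) ∧
        IsMaximalInvariantBorelIdeal (meagerNullIdeal A)) ∧
      (∀ A ∈ 𝒜, ∀ B ∈ 𝒜, A ≠ B → meagerNullIdeal A ≠ meagerNullIdeal B)) ∧
    𝔠 ≤ #{I : Set (Set (CantorGroup ℕ)) // IsMaximalInvariantBorelIdeal I} := by
  have hmax : ∀ A : Set ℕ, A.Infinite → IsMaximalInvariantBorelIdeal (meagerNullIdeal A) :=
    fun A hA => (hasWSP_meagerNullIdeal A).isMaximal (isInvariantBorelIdeal_meagerNullIdeal hA)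
  have hne : ∀ 𝒜 : Set (Set ℕ), IsAlmostDisjointFamily 𝒜 →
      ∀ A ∈ 𝒜, ∀ B ∈ 𝒜, A ≠ B → meagerNullIdeal A ≠ meagerNullIdeal B := by
    intro 𝒜 h𝒜 A hA B hB hAB
    refine meagerNullIdeal_ne ?_
    rw [← sdiff_inter_self_eq_sdiff]
    exact (h𝒜.1 B hB).sdiff (h𝒜.2 A hA B hB hAB)
  refine ⟨exists_isAlmostDisjointFamily_mk_eq_continuum, fun 𝒜 h𝒜 _ =>
    ⟨fun A hA => ⟨hasWSP_meagerNullIdeal A, hmax A (h𝒜.1 A hA)⟩, hne 𝒜 h𝒜⟩, ?_⟩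
  obtain ⟨𝒜, h𝒜, hcard⟩ := exists_isAlmostDisjointFamily_mk_eq_continuum
  rw [← hcard]
  refine Cardinal.mk_le_of_injective
    (f := fun A : 𝒜 => ⟨meagerNullIdeal A, hmax A (h𝒜.1 A A.2)⟩) fun A B hAB => ?_
  by_contra h
  exact hne 𝒜 h𝒜 A A.2 B B.2 (fun h' => h (Subtype.ext h')) (congrArg Subtype.val hAB)
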